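/- A $2\times 4$ state is a density matrix (positive semidefinite, trace one) $\rho$ on $\mathbb C^2\otimes\mathbb C^4$. It is separable if $\rho=\sum_j\mu_j\,|a_j\rangle\langle a_j|\otimes|b_j\rangle\langle b_j|$ is a finite sum with $\mu_j>0$, $\sum_j\mu_j=1$ and unit vectors $a_j,b_j$; it is PPT if its partial transpose $\rho^{T_A}$ (the linear extension of $\sigma\otimes S\mapsto\sigma^T\otimes S$) is positive semidefinite. Separability of two-qubit ($2\times 2$) states is defined in the same way. A $2\times4$ state of rank $2$ is in canonical form if $\rho=\lambda|\psi_1\rangle\langle\psi_1|+(1-\lambda)|\psi_2\rangle\langle\psi_2|$, where $0<\lambda<1$, and $\psi_1=(q_1,0,0,0,0,q_6,0,0)^T$ and $\psi_2=(p_1,\dots,p_8)^T$ are orthogonal unit vectors with $q_1,q_6>0$, $p_1,p_6$ real, $p_1\ge 0$, $p_6\le 0$, $p_4=0$ (so that $p_1q_1+p_6q_6=0$). **Lemma 3.4.** Let $\rho$ be a $2\times 4$ state of rank $2$ in canonical form. Then $\rho$ is PPT if and only if it has the form $$\rho=\begin{pmatrix}\rho_{11}&0&\rho_{12}&0\\0&0&0&0\\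 \rho_{12}^\dagger&0&\rho_{22}&0\\0&0&0&0\end{pmatrix}$$ with $2\times 2$ blocks, such that the $4\times 4$ matrix $\tilde\rho=\begin{pmatrix}\rho_{11}&\rho_{12}\\ \rho_{12}^\dagger&\rho_{22}\end{pmatrix}$ is separable as a two-qubit state. Here $\rho$ has the displayed block form if and only if $p_3=p_4=p_7=p_8=0$. Moreover, $\rho$ is PPT if and only if it is separable. Consequently, every $2\times4$ state of rank $2$ (in canonical form or not) is PPT if and only if it is separable. -/

import Mathlib

open scoped ComplexOrder Kronecker

/-- A density matrix: positive semidefinite (in particular Hermitian) of trace one. -/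
def IsDensityMatrix {ι : Type*} [Fintype ι] (ρ : Matrix ι ι ℂ) : Prop :=
  ρ.PosSemidef ∧ ρ.trace = 1

/-- The rank-one operator `|ψ⟩⟨ψ|`, with entries `ψ i * conj (ψ j)`. -/
def ketBra {ι : Type*} (ψ : ι → ℂ) : Matrix ι ι ℂ :=
  Matrix.vecMulVec ψ (star ψ)

/-- `ψ` is a unit vector for the standard Hermitian inner product. -/
def IsUnitVec {ι : Type*} [Fintype ι] (ψ : ι → ℂ) : Prop :=
  star ψ ⬝ᵥ ψ = 1

/-- Separability: a finite convex combination of product pure states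
`|a⟩⟨a| ⊗ |b⟩⟨b|` with unit vectors `a`, `b`. Such a matrix is automatically a density matrix. -/
def IsSeparableState {α β : Type*} [Fintype α] [Fintype β] (ρ : Matrix (α × β) (α × β) ℂ) : Prop :=
  ∃ (n : ℕ) (μ : Fin n → ℝ) (a : Fin n → α → ℂ) (b : Fin n → β → ℂ),
    (∀ j, 0 < μ j) ∧ ∑ j, μ j = 1 ∧ (∀ j, IsUnitVec (a j)) ∧ (∀ j, IsUnitVec (b j)) ∧
      ρ = ∑ j, (μ j : ℂ) • (ketBra (a j) ⊗ₖ ketBra (b j))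

/-- Partial transposition on the first factor: the linear map with `σ ⊗ S ↦ σᵀ ⊗ S`. -/
def partialTransposeA {α β : Type*} (ρ : Matrix (α × β) (α × β) ℂ) :
    Matrix (α × β) (α × β) ℂ :=
  fun x y => ρ (y.1, x.2) (x.1, y.2)

/-- Positivity of the partial transpose. -/
def IsPPT {α β : Type*} (ρ : Matrix (α × β) (α × β) ℂ) : Prop :=
  (partialTransposeA ρ).PosSemidef

/-- The vector `ψ₁ = (q₁, 0, 0, 0, 0, q₆, 0, 0)` of `ℂ² ⊗ ℂ⁴`. The coordinate number
`4 j + k + 1` (with `j < 2`, `k < 4`) in the list of eight is the one with index `(j, k)`. -/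
def canonicalPsi₁ (q₁ q₆ : ℝ) : Fin 2 × Fin 4 → ℂ :=
  fun x => if x = (0, 0) then (q₁ : ℂ) else if x = (1, 1) then (q₆ : ℂ) else 0

/-- `ρ` is a `2 × 4` state in canonical form, with parameters `lam`, `q₁`, `q₆` and second
eigenvector `p = (p₁, …, p₈)`: thus `p₁ = p (0, 0)`, `p₄ = p (0, 3)`, `p₆ = p (1, 1)`.
In the order of `ℂ`, `0 ≤ z` says that `z` is real and nonnegative. -/
structure IsCanonicalForm (ρ : Matrix (Fin 2 × Fin 4) (Fin 2 × Fin 4) ℂ)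
    (lam q₁ q₆ : ℝ) (p : Fin 2 × Fin 4 → ℂ) : Prop where
  lam_pos : 0 < lam
  lam_lt_one : lam < 1
  q₁_pos : 0 < q₁
  q₆_pos : 0 < q₆
  unit₁ : IsUnitVec (canonicalPsi₁ q₁ q₆)
  unit₂ : IsUnitVec p
  p₁_nonneg : 0 ≤ p (0, 0)
  p₆_nonpos : p (1, 1) ≤ 0
  p₄_zero : p (0, 3) = 0
  orthogonal : p (0, 0) * q₁ + p (1, 1) * q₆ = 0
  eq_rho : ρ = (lam : ℂ) • ketBra (canonicalPsi₁ q₁ q₆) + ((1 - lam : ℝ) : ℂ) • ketBra p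

/-- The `4 × 4` matrix with upper left `2 × 2` block `R` and the other blocks zero. -/
def padBlock (R : Matrix (Fin 2) (Fin 2) ℂ) : Matrix (Fin 4) (Fin 4) ℂ :=
  Matrix.reindex finSumFinEquiv finSumFinEquiv
    (Matrix.fromBlocks R 0 0 (0 : Matrix (Fin 2) (Fin 2) ℂ))

/-- The `8 × 8` matrix with block rows `(R₁₁, 0, R₁₂, 0)`, `(0, 0, 0, 0)`, `(R₁₂†, 0, R₂₂, 0)`,
`(0, 0, 0, 0)`, all blocks being `2 × 2`. -/
def blockForm (R₁₁ R₁₂ R₂₂ : Matrix (Fin 2) (Fin 2) ℂ) :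
    Matrix (Fin 2 × Fin 4) (Fin 2 × Fin 4) ℂ :=
  Matrix.comp _ _ _ _ _ !![padBlock R₁₁, padBlock R₁₂; padBlock R₁₂.conjTranspose, padBlock R₂₂]

/-- The `4 × 4` matrix with block rows `(R₁₁, R₁₂)`, `(R₁₂†, R₂₂)`. -/
def twoQubitBlock (R₁₁ R₁₂ R₂₂ : Matrix (Fin 2) (Fin 2) ℂ) :
    Matrix (Fin 2 × Fin 2) (Fin 2 × Fin 2) ℂ :=
  Matrix.comp _ _ _ _ _ !![R₁₁, R₁₂; R₁₂.conjTranspose, R₂₂]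

/-! Write a rank-two state as `V Vᴴ` with `V` injective on `ℂ²`, and let `X`, `Y` be its two block
rows. Replacing `V` by `V U` with `U` unitary does not change the state, so separability follows
once some `U` turns both columns of `V` into product vectors.

If `X` is injective, positivity of the partial transpose forces `Y = X T` with `T` a `2 × 2` matrix
(`PPTForm.eq_mul`) and makes `T` normal: `U` triangularizes `T`, and positivity kills the remaining
off-diagonal entry (`PPTForm.upper_eq_zero`). A shear `X + τ Y` reduces to this case unless the
whole real pencil is singular; then the vanishing of its minors already gives product columns
(`hasProductColumns_of_pencil_singular`). The converse holds because transposing one factor of a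
product state keeps it positive.

For a canonical state, `ψ₁` lies in the span of the two product vectors and has Schmidt rank two.
Their `ℂ⁴` factors therefore lie in the two-dimensional support of `ψ₁`, which gives the block form.
-/

/-! ### The positivity form and its shear invariance. -/

/-- The quadratic form of the partial transpose of `V Vᴴ`, where `V` has the block rows `X`, `Y`,
is nonnegative. -/
def PPTForm {ι κ : Type*} [Fintype ι] [Fintype κ] (X Y : Matrix ι κ ℂ) : Prop :=
  ∀ s t : ι → ℂ, 0 ≤ ∑ m, (Complex.normSq (Matrix.vecMul s X m)
    + Complex.normSq (Matrix.vecMul t Y m)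
    + 2 * (Matrix.vecMul s Y m * star (Matrix.vecMul t X m)).re)

/-- The shear acts on the first tensor factor only; the substitution `t ↦ t + τ s` absorbs it. -/
theorem PPTForm.add_smul {ι κ : Type*} [Fintype ι] [Fintype κ] {X Y : Matrix ι κ ℂ}
    (h : PPTForm X Y) (τ : ℝ) : PPTForm (X + (τ : ℂ) • Y) Y := by
  intro s t
  refine (h s (t + (τ : ℂ) • s)).trans_eq (Finset.sum_congr rfl fun m _ => ?_)
  simp only [Matrix.vecMul_add, Matrix.add_vecMul, Matrix.vecMul_smul, Matrix.smul_vecMul,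
    Pi.add_apply, Pi.smul_apply, smul_eq_mul, Complex.normSq_apply, Complex.add_re, Complex.add_im,
    Complex.mul_re, Complex.mul_im, Complex.ofReal_re, Complex.ofReal_im, Complex.star_def,
    Complex.conj_re, Complex.conj_im]
  ring

/-! ### Linear algebra on `ℂ²`. -/

/-- A nonzero vector of `ℂ²` spans the first column of a unitary matrix. -/
theorem exists_unitary_col_zero (u : Fin 2 → ℂ) (hu : u ≠ 0) :
    ∃ (U : Matrix (Fin 2) (Fin 2) ℂ) (c : ℂ), U * U.conjTranspose = 1 ∧ ∀ i, U i 0 = c * u i := by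
  have hpos : 0 < Complex.normSq (u 0) + Complex.normSq (u 1) := by
    by_contra hcon
    have h0 := Complex.normSq_nonneg (u 0)
    have h1 := Complex.normSq_nonneg (u 1)
    have e0 : u 0 = 0 := Complex.normSq_eq_zero.1 (by linarith)
    have e1 : u 1 = 0 := Complex.normSq_eq_zero.1 (by linarith)
    exact hu (funext fun i => by fin_cases i <;> assumption)
  set r : ℝ := (√(Complex.normSq (u 0) + Complex.normSq (u 1)))⁻¹ with hr
  have hr2 : r * r * (Complex.normSq (u 0) + Complex.normSq (u 1)) = 1 := by
    rw [hr, ← mul_inv, Real.mul_self_sqrt hpos.le, inv_mul_cancel₀ hpos.ne']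
  have hr3 : (r : ℂ) * r * (u 0 * star (u 0) + u 1 * star (u 1)) = 1 := by
    rw [Complex.star_def, Complex.mul_conj, Complex.mul_conj]
    exact_mod_cast hr2
  refine ⟨!![r * u 0, -(r * star (u 1)); r * u 1, r * star (u 0)], r, ?_, fun i => ?_⟩
  · ext i j
    fin_cases i <;> fin_cases j <;>
      simp [Matrix.mul_apply, Fin.sum_univ_two] at hr3 ⊢ <;>
      first | ring1 | linear_combination hr3
  · fin_cases i <;> simp

/-- Every `2 × 2` matrix is unitarily similar to an upper triangular one. -/
theorem exists_unitary_triangular (T : Matrix (Fin 2) (Fin 2) ℂ) :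
    ∃ U T' : Matrix (Fin 2) (Fin 2) ℂ, U * U.conjTranspose = 1 ∧ T * U = U * T' ∧ T' 1 0 = 0 := by
  obtain ⟨d, hd⟩ := Module.End.exists_eigenvalue (Matrix.toLin' T)
  obtain ⟨u, hu⟩ := hd.exists_hasEigenvector
  have hTu : Matrix.mulVec T u = d • u := by simpa using hu.apply_eq_smul
  obtain ⟨U, c, hU, hc⟩ := exists_unitary_col_zero u hu.2
  have hU' : U.conjTranspose * U = 1 := mul_eq_one_comm.1 hU
  refine ⟨U, U.conjTranspose * (T * U), hU, by rw [← mul_assoc, hU, one_mul], ?_⟩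
  have hcol : ∀ i, (T * U) i 0 = d * U i 0 := fun i => by
    have := congrFun hTu i
    simp only [Matrix.mulVec, dotProduct, Fin.sum_univ_two, Pi.smul_apply, smul_eq_mul] at this
    simp only [Matrix.mul_apply, Fin.sum_univ_two, hc]
    linear_combination c * this
  have h10 := congrFun (congrFun hU' 1) 0
  simp only [Matrix.mul_apply, Fin.sum_univ_two, Matrix.one_apply] at h10
  rw [Matrix.mul_apply, Fin.sum_univ_two, hcol, hcol]
  rw [if_neg (by decide)] at h10
  linear_combination d * h10

theorem exists_left_inverse_of_mulVec_injective {ι : Type*} [Fintype ι] [DecidableEq ι]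
    {X : Matrix ι (Fin 2) ℂ} (h : ∀ u, X.mulVec u = 0 → u = 0) :
    ∃ L : Matrix (Fin 2) ι ℂ, L * X = 1 := by
  obtain ⟨g, hg⟩ := LinearMap.exists_leftInverse_of_injective (Matrix.toLin' X)
    (LinearMap.ker_eq_bot'.2 fun u hu => h u (by simpa using hu))
  refine ⟨LinearMap.toMatrix' g, ?_⟩
  have := congrArg LinearMap.toMatrix' hg
  rwa [LinearMap.toMatrix'_comp, LinearMap.toMatrix'_toLin', LinearMap.toMatrix'_id] at this

/-! ### Positivity when `X` has a left inverse: `Y = X T` with `T` normal. -/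

/-- If the partial transpose is positive, then the left kernel of `X` lies in that of `Y`. -/
theorem PPTForm.vecMul_eq_zero {ι κ : Type*} [Fintype ι] [Fintype κ] [DecidableEq κ]
    {X Y : Matrix ι κ ℂ} (h : PPTForm X Y) {L : Matrix κ ι ℂ} (hL : L * X = 1)
    {u : ι → ℂ} (hu : Matrix.vecMul u X = 0) : Matrix.vecMul u Y = 0 := by
  set y := Matrix.vecMul u Y with hy
  set t := Matrix.vecMul y L with ht
  have htX : Matrix.vecMul t X = y := by rw [ht, Matrix.vecMul_vecMul, hL, Matrix.vecMul_one]
  set N := ∑ m, Complex.normSq (y m) with hN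
  set K := ∑ m, Complex.normSq (Matrix.vecMul t Y m) with hK
  -- At `(u, -c t)` the `X` term of `u` vanishes, so the linear term in `c` must be harmless: this
  -- forces `N = 0`.
  have key : ∀ c : ℝ, 0 ≤ c ^ 2 * K - 2 * c * N := fun c => by
    refine (h u (-(c : ℂ) • t)).trans_eq ?_
    rw [hN, hK, Finset.mul_sum, Finset.mul_sum, ← Finset.sum_sub_distrib]
    refine Finset.sum_congr rfl fun m _ => ?_
    rw [Matrix.smul_vecMul, Matrix.smul_vecMul, htX, hu, ← hy]
    simp only [Pi.smul_apply, Pi.zero_apply, smul_eq_mul, Complex.normSq_apply,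
      Complex.mul_re, Complex.mul_im, Complex.neg_re, Complex.neg_im, Complex.ofReal_re,
      Complex.ofReal_im, Complex.star_def, Complex.conj_re, Complex.conj_im, Complex.zero_re,
      Complex.zero_im]
    ring
  have hN0 : 0 ≤ N := Finset.sum_nonneg fun m _ => Complex.normSq_nonneg _
  have hK0 : 0 ≤ K := Finset.sum_nonneg fun m _ => Complex.normSq_nonneg _
  have hNz : N = 0 := by
    -- The minimum is at `N / K`; the `+ 1` avoids dividing by zero and still gives a negative
    -- value.
    have h1 := key (N / (K + 1))
    have h2 : (N / (K + 1)) ^ 2 * K - 2 * (N / (K + 1)) * N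
        = -(N ^ 2 * (K + 2) / (K + 1) ^ 2) := by field_simp; ring
    rw [h2] at h1
    by_contra hne
    have : 0 < N ^ 2 * (K + 2) / (K + 1) ^ 2 := by positivity
    linarith
  funext m
  exact Complex.normSq_eq_zero.1
    ((Finset.sum_eq_zero_iff_of_nonneg fun m _ => Complex.normSq_nonneg _).1 hNz m
      (Finset.mem_univ m))

/-- The rows of `1 - X L` annihilate `X`, hence also `Y`. -/
theorem PPTForm.eq_mul {ι κ : Type*} [Fintype ι] [Fintype κ] [DecidableEq ι] [DecidableEq κ]
    {X Y : Matrix ι κ ℂ} (h : PPTForm X Y) {L : Matrix κ ι ℂ} (hL : L * X = 1) :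
    Y = X * (L * Y) := by
  ext i m
  have hX : (1 - X * L) * X = 0 := by
    rw [Matrix.sub_mul, Matrix.one_mul, Matrix.mul_assoc, hL, Matrix.mul_one, sub_self]
  have hu : Matrix.vecMul (Matrix.vecMul (Pi.single i 1) (1 - X * L)) X = 0 := by
    rw [Matrix.vecMul_vecMul, hX, Matrix.vecMul_zero]
  have := congrFun (h.vecMul_eq_zero hL hu) m
  rw [Matrix.vecMul_vecMul, Matrix.single_one_vecMul, Matrix.sub_mul, Matrix.one_mul,
    Matrix.mul_assoc] at this
  exact sub_eq_zero.1 this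

/-- Minimizing the form over `s` leaves an inequality between the norms of `T` and its adjoint on a
vector; for triangular `T` it fails unless `T` is diagonal. -/
theorem PPTForm.upper_eq_zero {ι : Type*} [Fintype ι] {X : Matrix ι (Fin 2) ℂ}
    {T : Matrix (Fin 2) (Fin 2) ℂ} (h : PPTForm X (X * T)) {L : Matrix (Fin 2) ι ℂ}
    (hL : L * X = 1) (hT : T 1 0 = 0) : T 0 1 = 0 := by
  have hs : ∀ σ, Matrix.vecMul (Matrix.vecMul σ L) X = σ := fun σ => by
    rw [Matrix.vecMul_vecMul, hL, Matrix.vecMul_one]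
  -- For `t X = (0, 1)` this `s` is the minimizer; the form takes the value `-|T 0 1|²`.
  have := h (Matrix.vecMul ![-star (T 0 1), -star (T 1 1)] L) (Matrix.vecMul ![0, 1] L)
  simp only [← Matrix.vecMul_vecMul, hs] at this
  simp [Matrix.vecMul, dotProduct, Fin.sum_univ_two, hT, Complex.normSq_apply] at this
  refine Complex.normSq_eq_zero.1 (le_antisymm ?_ (Complex.normSq_nonneg _))
  rw [Complex.normSq_apply]
  linarith

/-! ### Rotating the columns into product vectors. -/

/-- The columns of the matrix with block rows `X`, `Y` are product vectors. -/
def HasProductColumns {ι κ : Type*} (X Y : Matrix ι κ ℂ) : Prop :=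
  ∃ (a b : κ → ℂ) (W : Matrix ι κ ℂ), ∀ i m, X i m = a m * W i m ∧ Y i m = b m * W i m

theorem PPTForm.mul_unitary {ι : Type*} [Fintype ι] {X Y : Matrix ι (Fin 2) ℂ}
    (h : PPTForm X Y) {U : Matrix (Fin 2) (Fin 2) ℂ} (hU : U * U.conjTranspose = 1) :
    PPTForm (X * U) (Y * U) := by
  have inner : ∀ v w : Fin 2 → ℂ, ∑ m, Matrix.vecMul v U m * star (Matrix.vecMul w U m)
      = ∑ m, v m * star (w m) := fun v w => by
    change Matrix.vecMul v U ⬝ᵥ star (Matrix.vecMul w U) = v ⬝ᵥ star w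
    rw [Matrix.star_vecMul, ← Matrix.dotProduct_mulVec, Matrix.mulVec_mulVec, hU,
      Matrix.one_mulVec]
  have normSq_eq : ∀ z : ℂ, Complex.normSq z = (z * star z).re := fun z => by
    rw [Complex.star_def, Complex.mul_conj, Complex.ofReal_re]
  intro s t
  have := h s t
  simp only [normSq_eq, Finset.sum_add_distrib, ← Finset.mul_sum, ← Complex.re_sum] at this ⊢
  simpa only [← Matrix.vecMul_vecMul, inner] using this

theorem PPTForm.hasProductColumns_of_injective {ι : Type*} [Fintype ι] [DecidableEq ι]
    {X Y : Matrix ι (Fin 2) ℂ} (h : PPTForm X Y) (hX : ∀ u, X.mulVec u = 0 → u = 0) :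
    ∃ U : Matrix (Fin 2) (Fin 2) ℂ, U * U.conjTranspose = 1 ∧
      HasProductColumns (X * U) (Y * U) := by
  obtain ⟨L, hL⟩ := exists_left_inverse_of_mulVec_injective hX
  obtain ⟨U, T, hU, hT, hT0⟩ := exists_unitary_triangular (L * Y)
  have hY : Y * U = X * U * T := by
    rw [Matrix.mul_assoc X, ← hT, ← Matrix.mul_assoc, ← h.eq_mul hL]
  have hL' : U.conjTranspose * L * (X * U) = 1 := by
    rw [Matrix.mul_assoc, ← Matrix.mul_assoc L, hL, Matrix.one_mul]
    exact mul_eq_one_comm.1 hU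
  have hT1 : T 0 1 = 0 := (hY ▸ h.mul_unitary hU).upper_eq_zero hL' hT0
  refine ⟨U, hU, fun _ => 1, fun m => T m m, X * U, fun i m => ⟨(one_mul _).symm, ?_⟩⟩
  rw [hY, Matrix.mul_apply, Fin.sum_univ_two]
  fin_cases m <;> simp [hT0, hT1, mul_comm (T _ _)]

theorem minor_eq_zero_of_not_injective {ι : Type*} {X : Matrix ι (Fin 2) ℂ}
    (h : ¬∀ u, X.mulVec u = 0 → u = 0) (i j : ι) : X i 0 * X j 1 - X j 0 * X i 1 = 0 := by
  push Not at h
  obtain ⟨u, hu, hne⟩ := h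
  have e : ∀ k, X k 0 * u 0 + X k 1 * u 1 = 0 := fun k => by
    simpa [Matrix.mulVec, dotProduct, Fin.sum_univ_two] using congrFun hu k
  by_cases h0 : u 0 = 0
  · have h1 : u 1 ≠ 0 := fun h1 => hne (funext fun k => by fin_cases k <;> assumption)
    refine (mul_eq_zero.1 (?_ : u 1 * _ = 0)).resolve_left h1
    linear_combination X i 0 * e j - X j 0 * e i
  · refine (mul_eq_zero.1 (?_ : u 0 * _ = 0)).resolve_left h0
    linear_combination X j 1 * e i - X i 1 * e j

/-- Positivity plays no role here. Rotate a kernel vector of `X` into the first column: `X U` then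
has first column zero and `Y U` has first column `y ≠ 0`. The minors of the pencil make both second
columns multiples of `y`, so both product vectors share the factor `y`. -/
theorem hasProductColumns_of_pencil_singular {ι : Type*} {X Y : Matrix ι (Fin 2) ℂ}
    (hXY : ∀ u, X.mulVec u = 0 → Y.mulVec u = 0 → u = 0)
    (h : ∀ τ : ℝ, ¬∀ u, (X + (τ : ℂ) • Y).mulVec u = 0 → u = 0) :
    ∃ U : Matrix (Fin 2) (Fin 2) ℂ, U * U.conjTranspose = 1 ∧
      HasProductColumns (X * U) (Y * U) := by
  have hX0 := h 0
  rw [Complex.ofReal_zero, zero_smul, add_zero] at hX0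
  push Not at hX0
  obtain ⟨u, hu, hne⟩ := hX0
  obtain ⟨U, c, hU, hc⟩ := exists_unitary_col_zero u hne
  have hU' : U.conjTranspose * U = 1 := mul_eq_one_comm.1 hU
  have inj : ∀ w, U.mulVec w = 0 → w = 0 := fun w hw => by
    have := congrArg U.conjTranspose.mulVec hw
    rwa [Matrix.mulVec_mulVec, hU', Matrix.one_mulVec, Matrix.mulVec_zero] at this
  have inj' : ∀ w, U.conjTranspose.mulVec w = 0 → w = 0 := fun w hw => by
    have := congrArg U.mulVec hw
    rwa [Matrix.mulVec_mulVec, hU, Matrix.one_mulVec, Matrix.mulVec_zero] at this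
  have minor : ∀ (τ : ℝ) (i j : ι),
      (X * U + (τ : ℂ) • (Y * U)) i 0 * (X * U + (τ : ℂ) • (Y * U)) j 1
        - (X * U + (τ : ℂ) • (Y * U)) j 0 * (X * U + (τ : ℂ) • (Y * U)) i 1 = 0 := fun τ =>
    minor_eq_zero_of_not_injective fun hinj => h τ fun w hw => inj' w (hinj _ (by
      rw [← Matrix.smul_mul, ← Matrix.add_mul, Matrix.mulVec_mulVec, Matrix.mul_assoc, hU,
        Matrix.mul_one, hw]))
  simp only [Matrix.add_apply, Matrix.smul_apply, smul_eq_mul] at minor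
  have hx : ∀ i, (X * U) i 0 = 0 := fun i => by
    have := congrFun hu i
    simp only [Matrix.mulVec, dotProduct, Fin.sum_univ_two, Pi.zero_apply] at this
    simp only [Matrix.mul_apply, Fin.sum_univ_two, hc]
    linear_combination c * this
  have hy : ∃ i, (Y * U) i 0 ≠ 0 := by
    by_contra! hy
    have e0 : (![1, 0] : Fin 2 → ℂ) = 0 := inj _ (hXY _
      (by rw [Matrix.mulVec_mulVec]; funext i; simp [Matrix.mulVec, dotProduct, hx])
      (by rw [Matrix.mulVec_mulVec]; funext i; simp [Matrix.mulVec, dotProduct, hy]))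
    simpa using congrFun e0 0
  obtain ⟨k, hk⟩ := hy
  -- Each minor is a polynomial in `τ` with only linear and quadratic terms; its values at `1` and
  -- `-1` separate the two coefficients.
  have h1 : ∀ i, (Y * U) k 0 * (X * U) i 1 = (X * U) k 1 * (Y * U) i 0 := fun i => by
    have a := minor 1 k i
    have b := minor (-1) k i
    simp only [hx] at a b
    push_cast at a b
    linear_combination (a - b) / 2
  have h2 : ∀ i, (Y * U) k 0 * (Y * U) i 1 = (Y * U) k 1 * (Y * U) i 0 := fun i => by
    have a := minor 1 k i
    have b := minor (-1) k i
    simp only [hx] at a b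
    push_cast at a b
    linear_combination (a + b) / 2
  refine ⟨U, hU, ![0, (X * U) k 1 / (Y * U) k 0], ![1, (Y * U) k 1 / (Y * U) k 0],
    fun i _ => (Y * U) i 0, fun i m => ?_⟩
  fin_cases m
  · simp [hx]
  · constructor
    · simp only [Fin.mk_one, Matrix.cons_val_one, Matrix.cons_val_fin_one]
      rw [div_mul_eq_mul_div, eq_div_iff hk, mul_comm, h1]
    · simp only [Fin.mk_one, Matrix.cons_val_one, Matrix.cons_val_fin_one]
      rw [div_mul_eq_mul_div, eq_div_iff hk, mul_comm, h2]

/-- Undoing the shear only changes the `ℂ²` factors, from `a` to `a - τ b`. -/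
theorem PPTForm.hasProductColumns {ι : Type*} [Fintype ι] [DecidableEq ι]
    {X Y : Matrix ι (Fin 2) ℂ} (h : PPTForm X Y)
    (hXY : ∀ u, X.mulVec u = 0 → Y.mulVec u = 0 → u = 0) :
    ∃ U : Matrix (Fin 2) (Fin 2) ℂ, U * U.conjTranspose = 1 ∧
      HasProductColumns (X * U) (Y * U) := by
  by_cases hp : ∃ τ : ℝ, ∀ u, (X + (τ : ℂ) • Y).mulVec u = 0 → u = 0
  · obtain ⟨τ, hτ⟩ := hp
    obtain ⟨U, hU, a, b, W, hW⟩ := (h.add_smul τ).hasProductColumns_of_injective hτ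
    refine ⟨U, hU, fun m => a m - τ * b m, b, W, fun i m => ⟨?_, (hW i m).2⟩⟩
    obtain ⟨h1, h2⟩ := hW i m
    rw [Matrix.add_mul, Matrix.smul_mul, Matrix.add_apply, Matrix.smul_apply, smul_eq_mul,
      h2] at h1
    linear_combination h1
  · exact hasProductColumns_of_pencil_singular hXY (not_exists.1 hp)

/-! ### From a positive partial transpose to separability, and back. -/

theorem pptForm_of_isPPT {ι κ : Type*} [Fintype ι] [Fintype κ] {V : Matrix (Fin 2 × ι) κ ℂ}
    (h : IsPPT (V * V.conjTranspose)) :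
    PPTForm (Matrix.of fun k m => V (0, k) m) (Matrix.of fun k m => V (1, k) m) := by
  intro s t
  set X : Matrix ι κ ℂ := Matrix.of fun k m => V (0, k) m with hX
  set Y : Matrix ι κ ℂ := Matrix.of fun k m => V (1, k) m with hY
  have hpair : ∀ (a b : ι → ℂ) (A B : Matrix ι κ ℂ),
      ∑ m, Matrix.vecMul a A m * star (Matrix.vecMul b B m)
        = ∑ k, ∑ l, a k * ((∑ m, A k m * star (B l m)) * star (b l)) := fun a b A B => by
    simp only [Matrix.vecMul, dotProduct, star_sum, star_mul', Finset.sum_mul, Finset.mul_sum]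
    rw [Finset.sum_congr rfl fun m _ => Finset.sum_comm, Finset.sum_comm]
    refine Finset.sum_congr rfl fun k _ => ?_
    rw [Finset.sum_comm]
    refine Finset.sum_congr rfl fun l _ => Finset.sum_congr rfl fun m _ => ?_
    ring
  -- The test vector is conjugated because `PPTForm` lets `s` and `t` act as row vectors.
  have hq := h.dotProduct_mulVec_nonneg
    (fun x : Fin 2 × ι => if x.1 = 0 then star (s x.2) else star (t x.2))
  have heq : star (fun x : Fin 2 × ι => if x.1 = 0 then star (s x.2) else star (t x.2)) ⬝ᵥ
      (partialTransposeA (V * V.conjTranspose)).mulVec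
        (fun x : Fin 2 × ι => if x.1 = 0 then star (s x.2) else star (t x.2))
      = ∑ m, Matrix.vecMul s X m * star (Matrix.vecMul s X m)
        + ∑ m, Matrix.vecMul s Y m * star (Matrix.vecMul t X m)
        + ∑ m, Matrix.vecMul t X m * star (Matrix.vecMul s Y m)
        + ∑ m, Matrix.vecMul t Y m * star (Matrix.vecMul t Y m) := by
    rw [hpair, hpair, hpair, hpair]
    simp [dotProduct, Matrix.mulVec, Fintype.sum_prod_type, Fin.sum_univ_two, partialTransposeA,
      Matrix.mul_apply, hX, hY, mul_add, Finset.mul_sum, Finset.sum_add_distrib]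
    ring
  rw [heq] at hq
  refine (Complex.le_def.1 hq).1.trans_eq ?_
  simp only [Complex.add_re, Complex.re_sum, ← Finset.sum_add_distrib]
  refine Finset.sum_congr rfl fun m _ => ?_
  simp only [Complex.normSq_apply, Complex.mul_re, Complex.star_def, Complex.conj_re,
    Complex.conj_im]
  ring

theorem exists_product_decomposition {ι : Type*} [Fintype ι] [DecidableEq ι]
    {V : Matrix (Fin 2 × ι) (Fin 2) ℂ} (hV : ∀ u, V.mulVec u = 0 → u = 0)
    (h : IsPPT (V * V.conjTranspose)) :
    ∃ (a : Fin 2 → Fin 2 → ℂ) (b : Fin 2 → ι → ℂ), (∀ j, a j ≠ 0) ∧ (∀ j, b j ≠ 0) ∧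
      V * V.conjTranspose = ∑ j, ketBra (a j) ⊗ₖ ketBra (b j) := by
  obtain ⟨U, hU, a, b, W, hW⟩ := (pptForm_of_isPPT h).hasProductColumns fun u h0 h1 =>
    hV u (funext fun x => by
      obtain ⟨i, k⟩ := x
      fin_cases i
      · exact congrFun h0 k
      · exact congrFun h1 k)
  have hU' : U.conjTranspose * U = 1 := mul_eq_one_comm.1 hU
  have hVU : ∀ x m, (V * U) x m = ![a m, b m] x.1 * W x.2 m := fun x m => by
    obtain ⟨i, k⟩ := x
    fin_cases i
    · exact (hW k m).1
    · exact (hW k m).2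
  -- `V U` is injective, so none of its columns vanishes; this makes both factors of each product
  -- nonzero.
  have hne : ∀ m, ∃ x, (V * U) x m ≠ 0 := fun m => by
    by_contra! hm
    have h1 : (V * U).mulVec (Pi.single m 1) = 0 := funext fun x => by simp [hm]
    rw [← Matrix.mulVec_mulVec] at h1
    have h2 := congrArg U.conjTranspose.mulVec (hV _ h1)
    rw [Matrix.mulVec_mulVec, hU', Matrix.one_mulVec, Matrix.mulVec_zero] at h2
    simpa using congrFun h2 m
  refine ⟨fun m => ![a m, b m], fun m k => W k m, fun m hm => ?_, fun m hm => ?_, ?_⟩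
  · obtain ⟨x, hx⟩ := hne m
    have := congrFun hm x.1
    exact hx (by rw [hVU]; exact mul_eq_zero_of_left this _)
  · obtain ⟨x, hx⟩ := hne m
    have := congrFun hm x.2
    exact hx (by rw [hVU]; exact mul_eq_zero_of_right _ this)
  · have : V * V.conjTranspose = V * U * (V * U).conjTranspose := by
      rw [Matrix.conjTranspose_mul, Matrix.mul_assoc V U, ← Matrix.mul_assoc U, hU,
        Matrix.one_mul]
    rw [this]
    ext x y
    rw [Matrix.mul_apply, Matrix.sum_apply]
    refine Finset.sum_congr rfl fun m _ => ?_
    rw [Matrix.conjTranspose_apply, hVU, hVU]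
    simp only [ketBra, Matrix.kroneckerMap_apply, Matrix.vecMulVec_apply, Pi.star_apply, star_mul']
    ring

theorem exists_isUnitVec_smul {ι : Type*} [Fintype ι] {v : ι → ℂ} (hv : v ≠ 0) :
    ∃ (r : ℝ) (w : ι → ℂ), 0 < r ∧ IsUnitVec w ∧ ketBra v = (r : ℂ) • ketBra w := by
  have hpos : 0 < star v ⬝ᵥ v := Matrix.dotProduct_star_self_pos_iff.2 hv
  obtain ⟨r, hr⟩ : ∃ r : ℝ, star v ⬝ᵥ v = r := ⟨_, (Complex.eq_re_of_ofReal_le hpos.le)⟩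
  have hr0 : 0 < r := by rw [hr] at hpos; exact_mod_cast hpos
  have hs : ((√r : ℝ) : ℂ) * (√r : ℝ) = r := by exact_mod_cast Real.mul_self_sqrt hr0.le
  have hs0 : ((√r : ℝ) : ℂ) ≠ 0 := by exact_mod_cast (Real.sqrt_pos.2 hr0).ne'
  have hst : star ((√r : ℝ) : ℂ)⁻¹ = ((√r : ℝ) : ℂ)⁻¹ := by simp
  refine ⟨r, ((√r : ℝ) : ℂ)⁻¹ • v, hr0, ?_, ?_⟩
  · rw [IsUnitVec, star_smul, smul_dotProduct, dotProduct_smul, hr, hst, ← hs, smul_eq_mul,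
      smul_eq_mul]
    field_simp
  · rw [ketBra, ketBra, star_smul, hst, Matrix.smul_vecMulVec, Matrix.vecMulVec_smul, smul_smul,
      smul_smul, ← hs]
    field_simp
    rw [one_smul]

theorem trace_ketBra {ι : Type*} [Fintype ι] {v : ι → ℂ} (hv : IsUnitVec v) :
    (ketBra v).trace = 1 := by
  rw [ketBra, Matrix.trace_vecMulVec, dotProduct_comm]; exact hv

/-- Normalizing the vectors produces the weights, and trace one makes them sum to one. -/
theorem isSeparableState_of_eq_sum {α β : Type*} [Fintype α] [Fintype β] {n : ℕ}
    {ρ : Matrix (α × β) (α × β) ℂ} (htr : ρ.trace = 1) {a : Fin n → α → ℂ} {b : Fin n → β → ℂ}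
    (ha : ∀ j, a j ≠ 0) (hb : ∀ j, b j ≠ 0) (h : ρ = ∑ j, ketBra (a j) ⊗ₖ ketBra (b j)) :
    IsSeparableState ρ := by
  choose r a' hr ha' hra using fun j => exists_isUnitVec_smul (ha j)
  choose s b' hs hb' hsb using fun j => exists_isUnitVec_smul (hb j)
  have hρ : ρ = ∑ j, ((r j * s j : ℝ) : ℂ) • (ketBra (a' j) ⊗ₖ ketBra (b' j)) := by
    rw [h]
    refine Finset.sum_congr rfl fun j _ => ?_
    rw [hra, hsb, Matrix.smul_kronecker, Matrix.kronecker_smul, smul_smul, Complex.ofReal_mul]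
  refine ⟨n, fun j => r j * s j, a', b', fun j => mul_pos (hr j) (hs j), ?_, ha', hb', hρ⟩
  rw [hρ, Matrix.trace_sum] at htr
  simp only [Matrix.trace_smul, Matrix.trace_kronecker, trace_ketBra (ha' _), trace_ketBra (hb' _),
    smul_eq_mul, mul_one] at htr
  exact_mod_cast htr

theorem IsSeparableState.isPPT {α β : Type*} [Fintype α] [Fintype β]
    {ρ : Matrix (α × β) (α × β) ℂ} (h : IsSeparableState ρ) : IsPPT ρ := by
  obtain ⟨n, μ, a, b, hμ, -, -, -, rfl⟩ := h
  have : partialTransposeA (∑ j, (μ j : ℂ) • (ketBra (a j) ⊗ₖ ketBra (b j)))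
      = ∑ j, (μ j : ℂ) • ((ketBra (a j)).transpose ⊗ₖ ketBra (b j)) := by
    ext x y
    simp [partialTransposeA, Matrix.sum_apply]
  rw [IsPPT, this]
  refine Matrix.posSemidef_sum _ fun j _ => ?_
  refine Matrix.PosSemidef.smul (Matrix.PosSemidef.kronecker ?_ ?_) ?_
  · exact (Matrix.posSemidef_vecMulVec_self_star _).transpose
  · exact Matrix.posSemidef_vecMulVec_self_star _
  · exact_mod_cast (hμ j).le

/-! ### Spectral factorization in rank two. -/

/-- A positive semidefinite matrix of rank two is `V Vᴴ` with `V` injective. -/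
theorem exists_factor_of_rank_eq_two {ι : Type*} [Fintype ι] [DecidableEq ι] {ρ : Matrix ι ι ℂ}
    (h : ρ.PosSemidef) (hr : ρ.rank = 2) :
    ∃ V : Matrix ι (Fin 2) ℂ, (∀ u, V.mulVec u = 0 → u = 0) ∧ ρ = V * V.conjTranspose := by
  have hcard := h.isHermitian.rank_eq_card_non_zero_eigs
  set l := h.isHermitian.eigenvalues with hl
  set E : Matrix ι ι ℂ := (h.isHermitian.eigenvectorUnitary : Matrix ι ι ℂ) with hE
  have hl0 : ∀ i, 0 ≤ l i := h.eigenvalues_nonneg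
  rw [hr] at hcard
  obtain ⟨e⟩ : Nonempty (Fin 2 ≃ {i // l i ≠ 0}) := ⟨(Fintype.equivFinOfCardEq hcard.symm).symm⟩
  have hs : ∀ i, ((√(l i) : ℝ) : ℂ) * (√(l i) : ℝ) = l i := fun i => by
    exact_mod_cast Real.mul_self_sqrt (hl0 i)
  let V : Matrix ι (Fin 2) ℂ := Matrix.of fun x j => E x (e j) * (√(l (e j)) : ℝ)
  have hV : ρ = V * V.conjTranspose := by
    ext x y
    conv_lhs => rw [h.isHermitian.spectral_theorem]
    rw [Unitary.conjStarAlgAut_apply, Matrix.mul_apply, Matrix.mul_apply]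
    simp only [Matrix.mul_diagonal, Matrix.conjTranspose_apply, Matrix.star_apply, V,
      Matrix.of_apply, ← hE, ← hl, Function.comp]
    rw [e.sum_comp (fun i => E x i * ((√(l i) : ℝ) : ℂ) * star (E y i * ((√(l i) : ℝ) : ℂ))),
      ← Finset.sum_subtype (Finset.univ.filter fun i => l i ≠ 0) (by simp)
        (fun i => E x i * ((√(l i) : ℝ) : ℂ) * star (E y i * ((√(l i) : ℝ) : ℂ))),
      Finset.sum_filter_of_ne]
    · refine Finset.sum_congr rfl fun i _ => ?_
      rw [star_mul', show star ((√(l i) : ℝ) : ℂ) = (√(l i) : ℝ) from Complex.conj_ofReal _]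
      change E x i * ((l i : ℝ) : ℂ) * star (E y i) = _
      rw [← hs]
      ring
    · intro i _ hi hli
      simp [hli] at hi
  refine ⟨V, fun u hu => ?_, hV⟩
  have h1 : ρ.rank ≤ V.rank := by
    rw [hV]; exact Matrix.rank_mul_le_left _ _
  have h2 := V.mulVecLin.finrank_range_add_finrank_ker
  rw [← Matrix.rank, Module.finrank_fin_fun] at h2
  have h3 : V.mulVecLin.ker = ⊥ := Submodule.finrank_eq_zero.1 (by omega)
  exact LinearMap.ker_eq_bot'.1 h3 u hu

/-! ### The block form and its two-qubit compression. -/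

theorem padBlock_castAdd_castAdd (R : Matrix (Fin 2) (Fin 2) ℂ) (k l : Fin 2) :
    padBlock R (Fin.castAdd 2 k) (Fin.castAdd 2 l) = R k l := by
  simp only [padBlock, Matrix.reindex_apply, Matrix.submatrix_apply,
    finSumFinEquiv_symm_apply_castAdd]
  rfl

theorem padBlock_natAdd_left (R : Matrix (Fin 2) (Fin 2) ℂ) (k : Fin 2) (l : Fin 4) :
    padBlock R (Fin.natAdd 2 k) l = 0 := by
  refine Fin.addCases (m := 2) (n := 2) (fun l => ?_) (fun l => ?_) l <;>
    simp only [padBlock, Matrix.reindex_apply, Matrix.submatrix_apply,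
    finSumFinEquiv_symm_apply_castAdd, finSumFinEquiv_symm_apply_natAdd] <;> rfl

theorem padBlock_natAdd_right (R : Matrix (Fin 2) (Fin 2) ℂ) (k : Fin 4) (l : Fin 2) :
    padBlock R k (Fin.natAdd 2 l) = 0 := by
  refine Fin.addCases (m := 2) (n := 2) (fun k => ?_) (fun k => ?_) k <;>
    simp only [padBlock, Matrix.reindex_apply, Matrix.submatrix_apply,
    finSumFinEquiv_symm_apply_castAdd, finSumFinEquiv_symm_apply_natAdd] <;> rfl

section BlockForm

variable (R₁₁ R₁₂ R₂₂ : Matrix (Fin 2) (Fin 2) ℂ)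

theorem blockForm_castAdd_castAdd (i j k l : Fin 2) :
    blockForm R₁₁ R₁₂ R₂₂ (i, Fin.castAdd 2 k) (j, Fin.castAdd 2 l)
      = twoQubitBlock R₁₁ R₁₂ R₂₂ (i, k) (j, l) := by
  fin_cases i <;> fin_cases j <;>
    simp only [blockForm, twoQubitBlock, Matrix.comp_apply] <;>
    exact padBlock_castAdd_castAdd _ _ _

theorem blockForm_natAdd_left (i k : Fin 2) (y : Fin 2 × Fin 4) :
    blockForm R₁₁ R₁₂ R₂₂ (i, Fin.natAdd 2 k) y = 0 := by
  obtain ⟨j, l⟩ := y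
  fin_cases i <;> fin_cases j <;> simp only [blockForm, Matrix.comp_apply] <;>
    exact padBlock_natAdd_left _ _ _

theorem blockForm_natAdd_right (x : Fin 2 × Fin 4) (j l : Fin 2) :
    blockForm R₁₁ R₁₂ R₂₂ x (j, Fin.natAdd 2 l) = 0 := by
  obtain ⟨i, k⟩ := x
  fin_cases i <;> fin_cases j <;> simp only [blockForm, Matrix.comp_apply] <;>
    exact padBlock_natAdd_right _ _ _

variable {R₁₁ R₁₂ R₂₂}

theorem exists_eq_blockForm {ρ : Matrix (Fin 2 × Fin 4) (Fin 2 × Fin 4) ℂ} (h : ρ.IsHermitian)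
    (h0 : ∀ (i k : Fin 2) y, ρ (i, Fin.natAdd 2 k) y = 0) :
    ∃ R₁₁ R₁₂ R₂₂ : Matrix (Fin 2) (Fin 2) ℂ, ρ = blockForm R₁₁ R₁₂ R₂₂ := by
  have h1 : ∀ x (j l : Fin 2), ρ x (j, Fin.natAdd 2 l) = 0 := fun x j l => by
    rw [← h.apply, h0, star_zero]
  refine ⟨Matrix.of fun k l => ρ (0, Fin.castAdd 2 k) (0, Fin.castAdd 2 l),
    Matrix.of fun k l => ρ (0, Fin.castAdd 2 k) (1, Fin.castAdd 2 l),
    Matrix.of fun k l => ρ (1, Fin.castAdd 2 k) (1, Fin.castAdd 2 l), ?_⟩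
  ext ⟨i, k⟩ ⟨j, l⟩
  refine Fin.addCases (m := 2) (n := 2) (fun k => ?_) (fun k => ?_) k
  · refine Fin.addCases (m := 2) (n := 2) (fun l => ?_) (fun l => ?_) l
    · rw [blockForm_castAdd_castAdd]
      fin_cases i <;> fin_cases j
      · rfl
      · rfl
      · exact (h.apply _ _).symm
      · rfl
    · rw [h1, blockForm_natAdd_right]
  · rw [h0, blockForm_natAdd_left]

theorem IsSeparableState.blockForm (h : IsSeparableState (twoQubitBlock R₁₁ R₁₂ R₂₂)) :
    IsSeparableState (blockForm R₁₁ R₁₂ R₂₂) := by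
  obtain ⟨n, μ, a, b, hμ, hsum, ha, hb, hρ⟩ := h
  refine ⟨n, μ, a, fun j => Fin.append (b j) (0 : Fin 2 → ℂ), hμ, hsum, ha, fun j => ?_, ?_⟩
  · have := hb j
    rw [IsUnitVec, dotProduct] at this
    rw [IsUnitVec, dotProduct, Fin.sum_univ_add (a := 2) (b := 2)]
    simpa only [Pi.star_apply, Fin.append_left, Fin.append_right, Pi.zero_apply, mul_zero,
      Finset.sum_const_zero, add_zero] using this
  · ext ⟨i, k⟩ ⟨j, l⟩
    refine Fin.addCases (m := 2) (n := 2) (fun k => ?_) (fun k => ?_) k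
    · refine Fin.addCases (m := 2) (n := 2) (fun l => ?_) (fun l => ?_) l
      · rw [blockForm_castAdd_castAdd, hρ]
        simp [Matrix.sum_apply, ketBra, Matrix.vecMulVec_apply]
      · rw [blockForm_natAdd_right]
        simp [Matrix.sum_apply, ketBra, Matrix.vecMulVec_apply, -Fin.natAdd_eq_addNat]
    · rw [blockForm_natAdd_left]
      simp [Matrix.sum_apply, ketBra, Matrix.vecMulVec_apply, -Fin.natAdd_eq_addNat]

theorem IsUnitVec.ne_zero {ι : Type*} [Fintype ι] {v : ι → ℂ} (h : IsUnitVec v) : v ≠ 0 := by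
  rintro rfl
  simp [IsUnitVec] at h

theorem IsSeparableState.of_blockForm
    (h : IsSeparableState (_root_.blockForm R₁₁ R₁₂ R₂₂)) :
    IsSeparableState (twoQubitBlock R₁₁ R₁₂ R₂₂) := by
  obtain ⟨n, μ, a, b, hμ, hsum, ha, hb, hρ⟩ := h
  -- A zero diagonal entry is a sum of nonnegative terms, one for each product vector, so every term
  -- vanishes.
  have hb0 : ∀ j (k : Fin 2), b j (Fin.natAdd 2 k) = 0 := fun j k => by
    obtain ⟨i, hi⟩ := Function.ne_iff.1 (ha j).ne_zero
    have h0 := congrFun (congrFun hρ (i, Fin.natAdd 2 k)) (i, Fin.natAdd 2 k)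
    rw [blockForm_natAdd_left, Matrix.sum_apply] at h0
    have hterm : ∀ m, ((μ m : ℂ) • Matrix.kroneckerMap (· * ·) (ketBra (a m)) (ketBra (b m)))
        (i, Fin.natAdd 2 k) (i, Fin.natAdd 2 k)
        = ((μ m * (Complex.normSq (a m i) * Complex.normSq (b m (Fin.natAdd 2 k))) : ℝ) : ℂ) :=
      fun m => by
        simp [ketBra, Matrix.vecMulVec_apply, Complex.mul_conj]
    simp only [hterm] at h0
    rw [← Complex.ofReal_sum] at h0
    have h1 := (Finset.sum_eq_zero_iff_of_nonneg fun m _ => mul_nonneg (hμ m).le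
      (mul_nonneg (Complex.normSq_nonneg _) (Complex.normSq_nonneg _))).1
      (Complex.ofReal_eq_zero.1 h0.symm) j (Finset.mem_univ j)
    have hi' : Complex.normSq (a j i) ≠ 0 := fun h => hi (Complex.normSq_eq_zero.1 h)
    simpa [(hμ j).ne', hi'] using h1
  refine ⟨n, μ, a, fun j k => b j (Fin.castAdd 2 k), hμ, hsum, ha, fun j => ?_, ?_⟩
  · have := hb j
    rw [IsUnitVec, dotProduct, Fin.sum_univ_add (a := 2) (b := 2)] at this
    rw [IsUnitVec, dotProduct, ← this]
    simp only [Pi.star_apply, hb0, mul_zero, Finset.sum_const_zero, add_zero]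
  · ext ⟨i, k⟩ ⟨j, l⟩
    rw [← blockForm_castAdd_castAdd, hρ]
    simp [Matrix.sum_apply, ketBra, Matrix.vecMulVec_apply]

end BlockForm

/-- A positive semidefinite matrix of trace one that factors through `ℂ²` is separable as soon as
its partial transpose is positive. -/
theorem isSeparableState_of_isPPT {ι : Type*} [Fintype ι] [DecidableEq ι]
    {V : Matrix (Fin 2 × ι) (Fin 2) ℂ} (hV : ∀ u, V.mulVec u = 0 → u = 0)
    (htr : (V * V.conjTranspose).trace = 1) (h : IsPPT (V * V.conjTranspose)) :
    IsSeparableState (V * V.conjTranspose) := by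
  obtain ⟨a, b, ha, hb, hab⟩ := exists_product_decomposition hV h
  exact isSeparableState_of_eq_sum htr ha hb hab

theorem ketBra_mulVec {ι : Type*} [Fintype ι] (v w : ι → ℂ) :
    (ketBra v).mulVec w = (star v ⬝ᵥ w) • v := by
  rw [ketBra, Matrix.vecMulVec_mulVec]
  ext i
  simp [mul_comm]

/-! ### Canonical states. -/

namespace IsCanonicalForm

variable {ρ : Matrix (Fin 2 × Fin 4) (Fin 2 × Fin 4) ℂ} {lam q₁ q₆ : ℝ} {p : Fin 2 × Fin 4 → ℂ}

theorem trace_eq_one (h : IsCanonicalForm ρ lam q₁ q₆ p) : ρ.trace = 1 := by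
  rw [h.eq_rho, Matrix.trace_add, Matrix.trace_smul, Matrix.trace_smul, trace_ketBra h.unit₁,
    trace_ketBra h.unit₂]
  simp

/-- The columns are the eigenvectors scaled by the square roots of their eigenvalues; orthogonality
gives injectivity. -/
theorem exists_factor (h : IsCanonicalForm ρ lam q₁ q₆ p) :
    ∃ V : Matrix (Fin 2 × Fin 4) (Fin 2) ℂ,
      (∀ u, V.mulVec u = 0 → u = 0) ∧ ρ = V * V.conjTranspose := by
  have hl := h.lam_pos
  have hl' : 0 < 1 - lam := sub_pos.2 h.lam_lt_one
  have hs : ((√lam : ℝ) : ℂ) * (√lam : ℝ) = lam := by exact_mod_cast Real.mul_self_sqrt hl.le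
  have hs' : ((√(1 - lam) : ℝ) : ℂ) * (√(1 - lam) : ℝ) = (1 - lam : ℝ) := by
    exact_mod_cast Real.mul_self_sqrt hl'.le
  have hs0 : ((√lam : ℝ) : ℂ) ≠ 0 := by exact_mod_cast (Real.sqrt_pos.2 hl).ne'
  have hs0' : ((√(1 - lam) : ℝ) : ℂ) ≠ 0 := by exact_mod_cast (Real.sqrt_pos.2 hl').ne'
  refine ⟨Matrix.of fun x => ![(√lam : ℝ) * canonicalPsi₁ q₁ q₆ x, (√(1 - lam) : ℝ) * p x],
    fun u hu => ?_, ?_⟩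
  · have e : ∀ x, (√lam : ℝ) * canonicalPsi₁ q₁ q₆ x * u 0 + (√(1 - lam) : ℝ) * p x * u 1 = 0 :=
      fun x => by
        have := congrFun hu x
        simpa [Matrix.mulVec, dotProduct, Fin.sum_univ_two] using this
    have hq : ((q₁ : ℂ) * q₁ + q₆ * q₆) ≠ 0 := by
      have h1 := h.q₁_pos
      have h6 := h.q₆_pos
      have : q₁ * q₁ + q₆ * q₆ ≠ 0 := by positivity
      exact_mod_cast this
    have e0 : ((√lam : ℝ) : ℂ) * q₁ * u 0 + (√(1 - lam) : ℝ) * p (0, 0) * u 1 = 0 := by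
      simpa [canonicalPsi₁] using e (0, 0)
    have e1 : ((√lam : ℝ) : ℂ) * q₆ * u 0 + (√(1 - lam) : ℝ) * p (1, 1) * u 1 = 0 := by
      simpa [canonicalPsi₁] using e (1, 1)
    have hu0 : u 0 = 0 := by
      refine (mul_eq_zero.1 (?_ : ((√lam : ℝ) : ℂ) * (q₁ * q₁ + q₆ * q₆) * u 0 = 0)).resolve_left
        (mul_ne_zero hs0 hq)
      linear_combination q₁ * e0 + q₆ * e1 - (√(1 - lam) : ℝ) * u 1 * h.orthogonal
    obtain ⟨x, hx⟩ := Function.ne_iff.1 h.unit₂.ne_zero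
    have hu1 : u 1 = 0 := by
      have := e x
      rw [hu0, mul_zero, zero_add] at this
      exact (mul_eq_zero.1 this).resolve_left (mul_ne_zero hs0' hx)
    exact funext fun i => by fin_cases i <;> assumption
  · rw [h.eq_rho]
    ext x y
    simp only [Matrix.add_apply, Matrix.smul_apply, ketBra, Matrix.vecMulVec_apply, Pi.star_apply,
      Matrix.mul_apply, Fin.sum_univ_two, Matrix.conjTranspose_apply, Matrix.of_apply,
      Matrix.cons_val_zero, Matrix.cons_val_one, star_mul', smul_eq_mul,
      show ∀ r : ℝ, star (r : ℂ) = r from Complex.conj_ofReal, ← hs, ← hs']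
    ring

/-- This places `ψ₁` in the range of `ρ`, hence in the span of any product vectors decomposing `ρ`.
-/
theorem mulVec_canonicalPsi₁ (h : IsCanonicalForm ρ lam q₁ q₆ p) :
    ρ.mulVec (canonicalPsi₁ q₁ q₆) = (lam : ℂ) • canonicalPsi₁ q₁ q₆ := by
  have horth : star p ⬝ᵥ canonicalPsi₁ q₁ q₆ = 0 := by
    have := congrArg star h.orthogonal
    rw [star_add, star_mul', star_mul', star_zero] at this
    simpa [dotProduct, canonicalPsi₁, Fintype.sum_prod_type, Fin.sum_univ_two, Fin.sum_univ_four]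
      using this
  rw [h.eq_rho, Matrix.add_mulVec, Matrix.smul_mulVec, Matrix.smul_mulVec, ketBra_mulVec,
    ketBra_mulVec, horth, show star (canonicalPsi₁ q₁ q₆) ⬝ᵥ canonicalPsi₁ q₁ q₆ = 1 from h.unit₁]
  simp

theorem p_eq_zero_of_diag_eq_zero (h : IsCanonicalForm ρ lam q₁ q₆ p) {x : Fin 2 × Fin 4}
    (hx : ρ x x = 0) : p x = 0 := by
  rw [h.eq_rho] at hx
  have e : ((lam * Complex.normSq (canonicalPsi₁ q₁ q₆ x)
      + (1 - lam) * Complex.normSq (p x) : ℝ) : ℂ) = 0 := by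
    rw [← hx]
    simp [ketBra, Matrix.vecMulVec_apply, Complex.mul_conj]
  have e' := Complex.ofReal_eq_zero.1 e
  have h1 := mul_nonneg h.lam_pos.le (Complex.normSq_nonneg (canonicalPsi₁ q₁ q₆ x))
  have h2 := mul_nonneg (sub_pos.2 h.lam_lt_one).le (Complex.normSq_nonneg (p x))
  have h3 : (1 - lam) * Complex.normSq (p x) = 0 := by linarith
  exact Complex.normSq_eq_zero.1 ((mul_eq_zero.1 h3).resolve_left (sub_pos.2 h.lam_lt_one).ne')

/-- Both product vectors in the range of a canonical state with positive partial transpose are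
supported on the first two coordinates of `ℂ⁴`, because the entangled vector `ψ₁` is. -/
theorem apply_eq_zero_of_isPPT (h : IsCanonicalForm ρ lam q₁ q₆ p) (hρ : IsPPT ρ) (i k : Fin 2) :
    p (i, Fin.natAdd 2 k) = 0 := by
  obtain ⟨V, hV, hVρ⟩ := h.exists_factor
  rw [hVρ] at hρ
  obtain ⟨a, b, -, -, hab⟩ := exists_product_decomposition hV hρ
  rw [← hVρ] at hab
  obtain ⟨c, hc⟩ : ∃ c : Fin 2 → ℂ, ∀ x : Fin 2 × Fin 4, (lam : ℂ) * canonicalPsi₁ q₁ q₆ x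
      = c 0 * (a 0 x.1 * b 0 x.2) + c 1 * (a 1 x.1 * b 1 x.2) := by
    refine ⟨fun j => star (fun x : Fin 2 × Fin 4 => a j x.1 * b j x.2) ⬝ᵥ canonicalPsi₁ q₁ q₆,
      fun x => ?_⟩
    have hk : ∀ j, Matrix.kroneckerMap (· * ·) (ketBra (a j)) (ketBra (b j))
        = ketBra (fun x : Fin 2 × Fin 4 => a j x.1 * b j x.2) := fun j => by
      ext x y
      simp only [ketBra, Matrix.kroneckerMap_apply, Matrix.vecMulVec_apply, Pi.star_apply,
        star_mul']
      ring
    have := congrFun h.mulVec_canonicalPsi₁ x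
    rw [hab, Fin.sum_univ_two, hk, hk, Matrix.add_mulVec, ketBra_mulVec, ketBra_mulVec] at this
    exact this.symm
  have hl : (lam : ℂ) ≠ 0 := by exact_mod_cast h.lam_pos.ne'
  have hq₁ : (q₁ : ℂ) ≠ 0 := by exact_mod_cast h.q₁_pos.ne'
  have hq₆ : (q₆ : ℂ) ≠ 0 := by exact_mod_cast h.q₆_pos.ne'
  have h00 := hc (0, 0)
  have h01 := hc (0, 1)
  have h11 := hc (1, 1)
  have h0k := hc (0, Fin.natAdd 2 k)
  have h1k := hc (1, Fin.natAdd 2 k)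
  have hk0 : Fin.natAdd 2 k ≠ (0 : Fin 4) := by fin_cases k <;> decide
  have hk1 : Fin.natAdd 2 k ≠ (1 : Fin 4) := by fin_cases k <;> decide
  simp only [canonicalPsi₁, Prod.mk.injEq, hk0, hk1, and_false, if_false, mul_zero] at h0k h1k
  simp [canonicalPsi₁] at h00 h01 h11
  -- Read as a `2 × 4` matrix, `lam • ψ₁` is the product of the matrix of the `c j • a j` and that
  -- of the `b j`. Its leading minor `lam² q₁ q₆` is nonzero, so the first factor, of determinant
  -- `D`, is invertible; the zero columns of `ψ₁` are then zero columns of the `b j`.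
  set D := c 0 * a 0 0 * (c 1 * a 1 1) - c 1 * a 1 0 * (c 0 * a 0 1) with hD
  have hdet : D ≠ 0 := fun hD0 => by
    refine mul_ne_zero (mul_ne_zero hl hq₁) (mul_ne_zero hl hq₆) ?_
    have : (lam : ℂ) * q₁ * (lam * q₆) = D * (b 0 0 * b 1 1 - b 1 0 * b 0 1) := by
      rw [hD]
      linear_combination (lam : ℂ) * q₆ * h00
        + (c 0 * (a 0 0 * b 0 0) + c 1 * (a 1 0 * b 1 0)) * h11
        - (c 0 * (a 0 1 * b 0 0) + c 1 * (a 1 1 * b 1 0)) * h01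
    rw [this, hD0, zero_mul]
  have hb0 : b 0 (Fin.natAdd 2 k) = 0 := by
    refine (mul_eq_zero.1 (?_ : D * _ = 0)).resolve_left hdet
    rw [hD]
    linear_combination -(c 1 * a 1 1) * h0k + c 1 * a 1 0 * h1k
  have hb1 : b 1 (Fin.natAdd 2 k) = 0 := by
    refine (mul_eq_zero.1 (?_ : D * _ = 0)).resolve_left hdet
    rw [hD]
    linear_combination -(c 0 * a 0 0) * h1k + c 0 * a 0 1 * h0k
  refine h.p_eq_zero_of_diag_eq_zero ?_
  rw [hab, Fin.sum_univ_two, Matrix.add_apply]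
  simp [ketBra, Matrix.vecMulVec_apply, hb0, hb1, -Fin.natAdd_eq_addNat]

theorem exists_eq_blockForm_iff (h : IsCanonicalForm ρ lam q₁ q₆ p) :
    (∃ R₁₁ R₁₂ R₂₂ : Matrix (Fin 2) (Fin 2) ℂ, ρ = blockForm R₁₁ R₁₂ R₂₂) ↔
      ∀ i k : Fin 2, p (i, Fin.natAdd 2 k) = 0 := by
  constructor
  · rintro ⟨R₁₁, R₁₂, R₂₂, hR⟩ i k
    exact h.p_eq_zero_of_diag_eq_zero (by rw [hR, blockForm_natAdd_left])
  · intro hp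
    obtain ⟨V, -, hV⟩ := h.exists_factor
    refine exists_eq_blockForm (hV ▸ Matrix.isHermitian_mul_conjTranspose_self V) fun i k y => ?_
    have hk0 : Fin.natAdd 2 k ≠ (0 : Fin 4) := by fin_cases k <;> decide
    have hk1 : Fin.natAdd 2 k ≠ (1 : Fin 4) := by fin_cases k <;> decide
    have hψ : canonicalPsi₁ q₁ q₆ (i, Fin.natAdd 2 k) = 0 := by
      simp only [canonicalPsi₁, Prod.mk.injEq, hk0, hk1, and_false, if_false]
    rw [h.eq_rho, Matrix.add_apply, Matrix.smul_apply, Matrix.smul_apply, ketBra, ketBra,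
      Matrix.vecMulVec_apply, Matrix.vecMulVec_apply, hψ, hp, zero_mul, zero_mul, smul_zero,
      smul_zero, add_zero]

theorem isPPT_iff_isSeparableState (h : IsCanonicalForm ρ lam q₁ q₆ p) :
    IsPPT ρ ↔ IsSeparableState ρ := by
  refine ⟨fun hρ => ?_, IsSeparableState.isPPT⟩
  obtain ⟨V, hV, rfl⟩ := h.exists_factor
  exact isSeparableState_of_isPPT hV h.trace_eq_one hρ

end IsCanonicalForm

theorem lemma3p4 :
    (∀ (ρ : Matrix (Fin 2 × Fin 4) (Fin 2 × Fin 4) ℂ) (lam q₁ q₆ : ℝ) (p : Fin 2 × Fin 4 → ℂ),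
      IsCanonicalForm ρ lam q₁ q₆ p →
        (IsPPT ρ ↔ ∃ R₁₁ R₁₂ R₂₂ : Matrix (Fin 2) (Fin 2) ℂ,
          ρ = blockForm R₁₁ R₁₂ R₂₂ ∧ IsSeparableState (twoQubitBlock R₁₁ R₁₂ R₂₂)) ∧
        ((∃ R₁₁ R₁₂ R₂₂ : Matrix (Fin 2) (Fin 2) ℂ, ρ = blockForm R₁₁ R₁₂ R₂₂) ↔
          p (0, 2) = 0 ∧ p (0, 3) = 0 ∧ p (1, 2) = 0 ∧ p (1, 3) = 0) ∧
        (IsPPT ρ ↔ IsSeparableState ρ)) ∧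
    (∀ ρ : Matrix (Fin 2 × Fin 4) (Fin 2 × Fin 4) ℂ,
      IsDensityMatrix ρ → ρ.rank = 2 → (IsPPT ρ ↔ IsSeparableState ρ)) := by
  refine ⟨fun ρ lam q₁ q₆ p h => ⟨⟨fun hρ => ?_, ?_⟩, ?_, h.isPPT_iff_isSeparableState⟩,
    fun ρ hρ hr => ⟨fun hp => ?_, IsSeparableState.isPPT⟩⟩
  · obtain ⟨R₁₁, R₁₂, R₂₂, hR⟩ := h.exists_eq_blockForm_iff.2 (h.apply_eq_zero_of_isPPT hρ)
    exact ⟨R₁₁, R₁₂, R₂₂, hR, (hR ▸ h.isPPT_iff_isSeparableState.1 hρ).of_blockForm⟩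
  · rintro ⟨R₁₁, R₁₂, R₂₂, rfl, hsep⟩
    exact hsep.blockForm.isPPT
  · rw [h.exists_eq_blockForm_iff, Fin.forall_fin_two, Fin.forall_fin_two, Fin.forall_fin_two,
      and_assoc]
    rfl
  · obtain ⟨V, hV, rfl⟩ := exists_factor_of_rank_eq_two hρ.1 hr
    exact isSeparableState_of_isPPT hV hρ.2 hp
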